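/- Let $n\ge 1$, $m\ge 0$, $d=2^n$, $d'=2^m$. Identify the pure states of $k$ qubits with the unit sphere $S^{2\cdot 2^k-1}$ of $\mathbb{C}^{2^k}=\mathbb{R}^{2\cdot 2^k}$. An $(n,m)$-quantum code $\mathcal{C}$ consists of an isometric linear encoding $\mathbb{C}^{d'}\to\mathbb{C}^{d}$ with image $C$ (the code space) and unitary discrete errors $E_0=I,E_1,\dots,E_{d''-1}$ of $\mathbb{C}^{d}$ such that the subspaces $E_sC$ are mutually orthogonal and $d=d'd''$. Let $\Pi_s$ be the orthogonal projection onto $E_sC$. The correction circuit applied to a state $\psi$ measures the syndrome $s$ with probability $\|\Pi_s\psi\|^2$ and then outputs $E_s^{-1}\,\Pi_s\psi/\|\Pi_s\psi\|$. For $\sigma\in[0,1)$ and a pure state $\Phi$ of $k$ qubits, with $D=2^k$, the normal isotropic distribution centred at $\Phi$ with parameter $\sigma$ is the distribution on $S^{2D-1}$ with density $$f_n(\sigma,\theta_0)=\frac{(2D-2)!!}{(2\pi)^D}\,\frac{1-\sigma^2}{(1+\sigma^2-2\sigma\cos\theta_0)^D}$$ with respect to the surface measure, where $\theta_0$ is the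 angle between the point and $\Phi$ in $\mathbb{R}^{2D}$. The fidelity $F(X)\ge 0$ of a random state $X$ with respect to the pure state $\Phi$ is given by $F^2(X)=E\left[|\langle X|\Phi\rangle|^2\right]$. Let $\Phi_0$ be a pure $m$-qubit state, $\Phi$ its encoding, $\sigma_u\in[0,1)$ and $\sigma_c=\sigma_u^{\,n}$. Then the normal isotropic distributions centred at $\Phi_0$ with parameter $\sigma_u$ and at $\Phi$ with parameter $\sigma_c$ are probability distributions. Let $\Psi_0$ and $\Psi$ be random states with these respective distributions, and let $\tilde\Phi$ be the output of the correction circuit applied to $\Psi$. Then, with the fidelity of $\Psi_0$ taken with respect to $\Phi_0$ and those of $\tilde\Phi$ and $\Psi$ with respect to $\Phi$, $$F(\Psi_0)\ \ge\ F(\tilde\Phi)\ \ge\ F(\Psi),$$ and $$F^2(\Psi_0)=\frac{1+(d'-1)\sigma_u^2}{d'},\qquad F^2(\tilde\Phi)=\frac{1+(d'-1)\sigma_c^2}{d'},\qquad F^2(\Psi)=\frac{1+(d-1)\sigma_c^2}{d}.$$ -/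

import Mathlib

open MeasureTheory ProbabilityTheory
open scoped Nat InnerProductSpace

noncomputable section

/-- The space `ℂ^(2^k)` of `k`-qubit vectors in the computational basis. As a real inner product
space it is `ℝ^(2d)`, `d = 2^k`; the pure states are the points of its unit sphere `S^(2d-1)`. -/
abbrev Qubits (k : ℕ) : Type := EuclideanSpace ℂ (Fin (2 ^ k))

/-- The density `f_n(σ, θ₀)` of the normal distribution on `S^(2d-1)`, with respect to the surface
measure, as a function of the polar angle `θ₀`. -/
def normalDensity (d : ℕ) (σ θ₀ : ℝ) : ℝ :=
  (((2 * d - 2)‼ : ℕ) : ℝ) / (2 * Real.pi) ^ d *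
    ((1 - σ ^ 2) / (1 + σ ^ 2 - 2 * σ * Real.cos θ₀) ^ d)

/-- The normal isotropic distribution with parameter `σ` centred at the state `Φ`: it has density
`f_n(σ, θ₀)` with respect to the surface measure of the unit sphere, where `θ₀` is the angle between
the point and `Φ` in the underlying real Euclidean space. -/
def normalLaw {k : ℕ} (Φ : Qubits k) (σ : ℝ) : Measure (Qubits k) :=
  ((volume : Measure (Qubits k)).toSphere.withDensity fun x =>
    ENNReal.ofReal
      (normalDensity (2 ^ k) σ (InnerProductGeometry.angle Φ (x : Qubits k)))).map Subtype.val

/-- The fidelity `F(X)` of a random state `X` with respect to the pure state `Φ`: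
`F²(X) = E[|⟨X|Φ⟩|²]`. -/
def fidelity {k : ℕ} {Ω : Type*} [MeasurableSpace Ω] (P : Measure Ω) (X : Ω → Qubits k)
    (Φ : Qubits k) : ℝ :=
  Real.sqrt (∫ ω, ‖⟪X ω, Φ⟫_ℂ‖ ^ 2 ∂P)

/-- An `(n, m)`-quantum code: an isometric encoding of `m`-qubits as `n`-qubits, together with the
`d''` discrete (unitary) errors that it corrects. One of them is the identity; they move the code
space to mutually orthogonal subspaces, one for every syndrome, and `d = d' d''`, i.e. these
subspaces fill the whole space. -/
structure QuantumCode (n m : ℕ) where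
  /-- the encoding -/
  encode : Qubits m →ₗᵢ[ℂ] Qubits n
  /-- the number `d''` of discrete errors -/
  numErrors : ℕ
  /-- the discrete errors, indexed by their syndromes -/
  error : Fin numErrors → (Qubits n ≃ₗᵢ[ℂ] Qubits n)
  /-- the syndrome of the absence of error -/
  trivialSyndrome : Fin numErrors
  error_trivialSyndrome : error trivialSyndrome = LinearIsometryEquiv.refl ℂ (Qubits n)
  orthogonal : ∀ s t, s ≠ t → ∀ u v : Qubits m,
    ⟪error s (encode u), error t (encode v)⟫_ℂ = 0
  dim_eq : 2 ^ n = 2 ^ m * numErrors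

namespace QuantumCode

variable {n m : ℕ}

/-- The subspace of syndrome `s`: the image of the code space under the discrete error `E_s`. -/
def syndromeSpace (C : QuantumCode n m) (s : Fin C.numErrors) : Submodule ℂ (Qubits n) :=
  (LinearMap.range C.encode.toLinearMap).map (C.error s).toLinearEquiv.toLinearMap

/-- The orthogonal projection of `ψ` to the subspace of syndrome `s`. -/
def project (C : QuantumCode n m) (s : Fin C.numErrors) (ψ : Qubits n) : Qubits n :=
  (C.syndromeSpace s).starProjection ψ

/-- The output of the correction circuit on `ψ` when the syndrome `s` is measured: the normalized
projection of `ψ` to the subspace of syndrome `s`, moved back by the inverse of `E_s`. (If the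
projection is `0`, the syndrome `s` has probability `0`.) -/
def correct (C : QuantumCode n m) (s : Fin C.numErrors) (ψ : Qubits n) : Qubits n :=
  (C.error s).symm (((‖C.project s ψ‖⁻¹ : ℝ) : ℂ) • C.project s ψ)

/-- The random variable `S` is the syndrome measured on the random state `Ψ`: conditionally on `Ψ`,
the syndrome `s` has probability `‖Π_s Ψ‖²`. -/
def IsSyndromeOf (C : QuantumCode n m) {Ω : Type*} [MeasurableSpace Ω] (P : Measure Ω)
    (S : Ω → Fin C.numErrors) (Ψ : Ω → Qubits n) : Prop :=
  Measurable S ∧ ∀ (s : Fin C.numErrors) (B : Set (Qubits n)), MeasurableSet B →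
    P (S ⁻¹' {s} ∩ Ψ ⁻¹' B) =
      ∫⁻ ω in Ψ ⁻¹' B, ENNReal.ofReal (‖C.project s (Ψ ω)‖ ^ 2) ∂P

end QuantumCode

end

/-- Differentiation under the integral sign over a compact space. -/
theorem hasDerivAt_integral_of_compactSpace {X : Type*} [TopologicalSpace X] [CompactSpace X]
    [MeasurableSpace X] [OpensMeasurableSpace X] {μ : Measure X} [IsFiniteMeasure μ]
    {F F' : ℝ → X → ℝ} {U : Set ℝ} {a : ℝ} (hU : IsOpen U) (ha : a ∈ U)
    (hF : ContinuousOn (Function.uncurry F) (U ×ˢ Set.univ))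
    (hF' : ContinuousOn (Function.uncurry F') (U ×ˢ Set.univ))
    (hd : ∀ x, ∀ y ∈ U, HasDerivAt (fun y => F y x) (F' y x) y) :
    HasDerivAt (fun y => ∫ x, F y x ∂μ) (∫ x, F' a x ∂μ) a := by
  have slice : ∀ {G : ℝ → X → ℝ}, ContinuousOn (Function.uncurry G) (U ×ˢ Set.univ) →
      ∀ y ∈ U, Continuous (G y) := fun hG y hy =>
    hG.comp_continuous (Continuous.prodMk_right y) fun x => ⟨hy, Set.mem_univ x⟩
  obtain ⟨r, hr, hball⟩ := Metric.nhds_basis_closedBall.mem_iff.1 (hU.mem_nhds ha)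
  have hK : IsCompact (Metric.closedBall a r ×ˢ (Set.univ : Set X)) :=
    (isCompact_closedBall a r).prod isCompact_univ
  obtain ⟨M, hM⟩ := hK.exists_bound_of_continuousOn
    (hF'.mono (Set.prod_mono hball subset_rfl))
  refine (hasDerivAt_integral_of_dominated_loc_of_deriv_le (bound := fun _ => M)
    (Metric.closedBall_mem_nhds a hr) ?_ ?_ ?_ ?_ (integrable_const M) ?_).2
  · filter_upwards [hU.mem_nhds ha] with y hy
    exact (slice hF y hy).aestronglyMeasurable
  · exact (slice hF a ha).integrable_of_hasCompactSupport
      (HasCompactSupport.of_compactSpace _)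
  · exact (slice hF' a ha).aestronglyMeasurable
  · exact Filter.Eventually.of_forall fun x y hy => hM (y, x) ⟨hy, Set.mem_univ x⟩
  · exact Filter.Eventually.of_forall fun x y hy => hd x y (hball hy)

theorem inner_mem_Icc_of_mem_sphere {E : Type*} [NormedAddCommGroup E] [InnerProductSpace ℝ E]
    {p : E} (hp : ‖p‖ = 1)
    (x : Metric.sphere (0 : E) 1) :
    ⟪p, (x : E)⟫_ℝ ∈ Set.Icc (-1 : ℝ) 1 := by
  have := abs_real_inner_le_norm p (x : E)
  rw [hp, norm_eq_of_mem_sphere x, mul_one] at this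
  exact abs_le.1 this

section Sphere

variable {E : Type*} [NormedAddCommGroup E] [InnerProductSpace ℝ E] [FiniteDimensional ℝ E]
  [MeasurableSpace E] [BorelSpace E]

open scoped Pointwise in
/-- The surface measure of the unit sphere is invariant under linear isometries. -/
theorem integral_toSphere_comp_linearIsometryEquiv (f : E ≃ₗᵢ[ℝ] E) {h : E → ℝ}
    (hh : Continuous fun x : Metric.sphere (0 : E) 1 => h x) :
    ∫ x : Metric.sphere (0 : E) 1, h (f x) ∂(volume : Measure E).toSphere =
      ∫ x : Metric.sphere (0 : E) 1, h x ∂(volume : Measure E).toSphere := by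
  let T : Metric.sphere (0 : E) 1 → Metric.sphere (0 : E) 1 := fun x =>
    ⟨f x, by simp⟩
  have hT : Continuous T := by
    apply Continuous.subtype_mk
    exact f.continuous.comp continuous_subtype_val
  have hmap : (volume : Measure E).toSphere.map T = (volume : Measure E).toSphere := by
    ext s hs
    rw [Measure.map_apply hT.measurable hs, Measure.toSphere_apply' _ hs,
      Measure.toSphere_apply' _ (hT.measurable hs)]
    congr 1
    rw [← f.measurePreserving.measure_preimage_emb
      f.toHomeomorph.measurableEmbedding (Set.Ioo (0 : ℝ) 1 • (Subtype.val '' s))]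
    congr 1
    ext y
    simp only [Set.mem_smul, Set.mem_image, Set.mem_preimage]
    constructor
    · rintro ⟨r, hr, _, ⟨x, hx, rfl⟩, rfl⟩
      exact ⟨r, hr, _, ⟨T x, hx, rfl⟩, by simp [T]⟩
    · rintro ⟨r, hr, _, ⟨x, hx, rfl⟩, hy⟩
      refine ⟨r, hr, f.symm x, ⟨⟨f.symm x, by simp⟩, ?_, rfl⟩, ?_⟩
      · simpa [T] using hx
      · rw [← map_smul, hy, f.symm_apply_apply]
  conv_rhs => rw [← hmap]
  rw [integral_map hT.aemeasurable hh.aestronglyMeasurable]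

theorem integrable_toSphere_of_continuous {h : Metric.sphere (0 : E) 1 → ℝ} (hh : Continuous h) :
    Integrable h (volume : Measure E).toSphere :=
  hh.integrable_of_hasCompactSupport (HasCompactSupport.of_compactSpace _)

/-- Infinitesimal rotation invariance of the surface measure, in the plane spanned by `p, e`. -/
theorem integral_toSphere_inner_sq_mul_deriv {p e : E} (hp : ‖p‖ = 1) (he : ‖e‖ = 1)
    (hpe : ⟪p, e⟫_ℝ = 0) {g g' : ℝ → ℝ} (hg : ∀ t ∈ Set.Icc (-1 : ℝ) 1, HasDerivAt g (g' t) t)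
    (hg' : ContinuousOn g' (Set.Icc (-1) 1)) :
    ∫ x : Metric.sphere (0 : E) 1, ⟪e, (x : E)⟫_ℝ ^ 2 * g' ⟪p, (x : E)⟫_ℝ
        ∂(volume : Measure E).toSphere =
      ∫ x : Metric.sphere (0 : E) 1, ⟪p, (x : E)⟫_ℝ * g ⟪p, (x : E)⟫_ℝ
        ∂(volume : Measure E).toSphere := by
  have hgc : ContinuousOn g (Set.Icc (-1) 1) := fun t ht => (hg t ht).continuousAt.continuousWithinAt
  have hep : ⟪e, p⟫_ℝ = 0 := by rw [real_inner_comm, hpe]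
  have hpp : ⟪p, p⟫_ℝ = 1 := by rw [real_inner_self_eq_norm_sq, hp, one_pow]
  have hee : ⟪e, e⟫_ℝ = 1 := by rw [real_inner_self_eq_norm_sq, he, one_pow]
  let u : ℝ → E := fun α => Real.cos α • e + Real.sin α • p
  have hu : ∀ α, ‖u α‖ = 1 := fun α => by
    have : ‖u α‖ ^ 2 = 1 := by
      rw [← real_inner_self_eq_norm_sq]
      simp only [u, inner_add_left, inner_add_right, real_inner_smul_left, real_inner_smul_right,
        hep, hpe, hpp, hee]
      linear_combination Real.cos_sq_add_sin_sq α
    nlinarith [norm_nonneg (u α)]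
  let R : ℝ → (E ≃ₗᵢ[ℝ] E) := fun α => (ℝ ∙ u α)ᗮ.reflection
  have hR : ∀ α x, R α x = x - (2 * ⟪u α, x⟫_ℝ) • u α := fun α x => by
    simp only [R, Submodule.reflection_orthogonal_apply, Submodule.reflection_singleton_apply, hu]
    simp [two_smul, two_mul, add_smul]
  let T : ℝ → Metric.sphere (0 : E) 1 → ℝ := fun α x => ⟪p, (x : E)⟫_ℝ -
    2 * (Real.cos α * ⟪e, (x : E)⟫_ℝ + Real.sin α * ⟪p, (x : E)⟫_ℝ) * Real.sin α
  let S : ℝ → Metric.sphere (0 : E) 1 → ℝ := fun α x => ⟪e, (x : E)⟫_ℝ -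
    2 * (Real.cos α * ⟪e, (x : E)⟫_ℝ + Real.sin α * ⟪p, (x : E)⟫_ℝ) * Real.cos α
  let T' : ℝ → Metric.sphere (0 : E) 1 → ℝ := fun α x =>
    -(2 * (-Real.sin α * ⟪e, (x : E)⟫_ℝ + Real.cos α * ⟪p, (x : E)⟫_ℝ) * Real.sin α +
      2 * (Real.cos α * ⟪e, (x : E)⟫_ℝ + Real.sin α * ⟪p, (x : E)⟫_ℝ) * Real.cos α)
  let S' : ℝ → Metric.sphere (0 : E) 1 → ℝ := fun α x =>
    -(2 * (-Real.sin α * ⟪e, (x : E)⟫_ℝ + Real.cos α * ⟪p, (x : E)⟫_ℝ) * Real.cos α +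
      2 * (Real.cos α * ⟪e, (x : E)⟫_ℝ + Real.sin α * ⟪p, (x : E)⟫_ℝ) * -Real.sin α)
  have hTR : ∀ α (x : Metric.sphere (0 : E) 1), ⟪p, R α x⟫_ℝ = T α x := fun α x => by
    simp only [hR, T, u, inner_sub_right, inner_add_left, inner_add_right, real_inner_smul_left,
      real_inner_smul_right, hpe, hpp]
    ring
  have hSR : ∀ α (x : Metric.sphere (0 : E) 1), ⟪e, R α x⟫_ℝ = S α x := fun α x => by
    simp only [hR, S, u, inner_sub_right, inner_add_left, inner_add_right, real_inner_smul_left,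
      real_inner_smul_right, hep, hee]
    ring
  have hTmem : ∀ α x, T α x ∈ Set.Icc (-1 : ℝ) 1 := fun α x => by
    rw [← hTR]
    exact inner_mem_Icc_of_mem_sphere hp ⟨R α x, by simp⟩
  have hlin : ∀ α x, HasDerivAt (fun α => 2 * (Real.cos α * ⟪e, (x : E)⟫_ℝ +
      Real.sin α * ⟪p, (x : E)⟫_ℝ))
      (2 * (-Real.sin α * ⟪e, (x : E)⟫_ℝ + Real.cos α * ⟪p, (x : E)⟫_ℝ)) α := fun α x =>
    (((Real.hasDerivAt_cos α).mul_const _).add ((Real.hasDerivAt_sin α).mul_const _)).const_mul 2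
  have hTd : ∀ α x, HasDerivAt (fun α => T α x) (T' α x) α := fun α x =>
    ((hlin α x).mul (Real.hasDerivAt_sin α)).const_sub _
  have hSd : ∀ α x, HasDerivAt (fun α => S α x) (S' α x) α := fun α x =>
    ((hlin α x).mul (Real.hasDerivAt_cos α)).const_sub _
  have hTc : Continuous (Function.uncurry T) := by
    simp only [T, Function.uncurry_def]; fun_prop
  have hSc : Continuous (Function.uncurry S) := by
    simp only [S, Function.uncurry_def]; fun_prop
  have hTc' : Continuous (Function.uncurry T') := by
    simp only [T', Function.uncurry_def]; fun_prop
  have hSc' : Continuous (Function.uncurry S') := by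
    simp only [S', Function.uncurry_def]; fun_prop
  have hgT : Continuous fun z : ℝ × Metric.sphere (0 : E) 1 => g (T z.1 z.2) :=
    hgc.comp_continuous hTc fun z => hTmem z.1 z.2
  have hgT' : Continuous fun z : ℝ × Metric.sphere (0 : E) 1 => g' (T z.1 z.2) :=
    hg'.comp_continuous hTc fun z => hTmem z.1 z.2
  have key := hasDerivAt_integral_of_compactSpace (μ := (volume : Measure E).toSphere)
    (F := fun α x => g (T α x) * S α x)
    (F' := fun α x => g' (T α x) * T' α x * S α x + g (T α x) * S' α x)
    isOpen_univ (Set.mem_univ (0 : ℝ)) (hgT.mul hSc).continuousOn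
    (((hgT'.mul hTc').mul hSc).add (hgT.mul hSc')).continuousOn
    (fun x α _ => ((hg _ (hTmem α x)).comp α (hTd α x)).mul (hSd α x))
  have hgp : Continuous fun x : Metric.sphere (0 : E) 1 => g ⟪p, (x : E)⟫_ℝ :=
    hgc.comp_continuous (by fun_prop) fun x => inner_mem_Icc_of_mem_sphere hp x
  have hgp' : Continuous fun x : Metric.sphere (0 : E) 1 => g' ⟪p, (x : E)⟫_ℝ :=
    hg'.comp_continuous (by fun_prop) fun x => inner_mem_Icc_of_mem_sphere hp x
  have hconst : (fun α => ∫ x, g (T α x) * S α x ∂(volume : Measure E).toSphere) =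
      fun _ => ∫ x : Metric.sphere (0 : E) 1, g ⟪p, (x : E)⟫_ℝ * ⟪e, (x : E)⟫_ℝ
        ∂(volume : Measure E).toSphere := by
    funext α
    simp only [← hTR, ← hSR]
    exact integral_toSphere_comp_linearIsometryEquiv (R α)
      (h := fun x => g ⟪p, x⟫_ℝ * ⟪e, x⟫_ℝ) (hgp.mul (by fun_prop))
  rw [hconst] at key
  have h0 := key.unique (hasDerivAt_const _ _)
  have h1 : ∫ x : Metric.sphere (0 : E) 1, 2 * (⟪e, (x : E)⟫_ℝ ^ 2 * g' ⟪p, (x : E)⟫_ℝ -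
      ⟪p, (x : E)⟫_ℝ * g ⟪p, (x : E)⟫_ℝ) ∂(volume : Measure E).toSphere = 0 := by
    rw [← h0]
    congr 1
    funext x
    simp only [T, S, T', S', Real.cos_zero, Real.sin_zero]
    ring_nf
  rw [integral_const_mul, integral_sub
    (integrable_toSphere_of_continuous (by exact .mul (by fun_prop) hgp'))
    (integrable_toSphere_of_continuous (by exact .mul (by fun_prop) hgp))] at h1
  linarith

/-- The directions orthogonal to the axis of a zonal weight all have the same second moment. -/
theorem integral_toSphere_inner_sq_mul_zonal {p e : E} (hp : ‖p‖ = 1) (he : ‖e‖ = 1)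
    (hpe : ⟪p, e⟫_ℝ = 0) {w : ℝ → ℝ} (hw : ContinuousOn w (Set.Icc (-1) 1)) :
    ((Module.finrank ℝ E : ℝ) - 1) *
        ∫ x : Metric.sphere (0 : E) 1, ⟪e, (x : E)⟫_ℝ ^ 2 * w ⟪p, (x : E)⟫_ℝ
          ∂(volume : Measure E).toSphere =
      ∫ x : Metric.sphere (0 : E) 1, (1 - ⟪p, (x : E)⟫_ℝ ^ 2) * w ⟪p, (x : E)⟫_ℝ
          ∂(volume : Measure E).toSphere := by
  have hwp : Continuous fun x : Metric.sphere (0 : E) 1 => w ⟪p, (x : E)⟫_ℝ :=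
    hw.comp_continuous (by fun_prop) fun x => inner_mem_Icc_of_mem_sphere hp x
  have hsymm : ∀ e' : E, ‖e'‖ = 1 → ⟪p, e'⟫_ℝ = 0 →
      ∫ x : Metric.sphere (0 : E) 1, ⟪e', (x : E)⟫_ℝ ^ 2 * w ⟪p, (x : E)⟫_ℝ
          ∂(volume : Measure E).toSphere =
        ∫ x : Metric.sphere (0 : E) 1, ⟪e, (x : E)⟫_ℝ ^ 2 * w ⟪p, (x : E)⟫_ℝ
          ∂(volume : Measure E).toSphere := by
    intro e' he' hpe'
    let R := (ℝ ∙ (e - e'))ᗮ.reflection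
    have hRe : R e = e' := Submodule.reflection_sub (he.trans he'.symm)
    have hRp : R p = p := by
      apply Submodule.reflection_mem_subspace_eq_self
      rw [Submodule.mem_orthogonal_singleton_iff_inner_left, inner_sub_right, hpe, hpe', sub_zero]
    rw [← integral_toSphere_comp_linearIsometryEquiv R
      (h := fun x => ⟪e', x⟫_ℝ ^ 2 * w ⟪p, x⟫_ℝ) (.mul (by fun_prop) hwp)]
    congr 1
    funext x
    have h1 : ⟪e', R x⟫_ℝ = ⟪e, (x : E)⟫_ℝ := by rw [← hRe, R.inner_map_map]
    have h2 : ⟪p, R x⟫_ℝ = ⟪p, (x : E)⟫_ℝ := by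
      conv_lhs => rw [← hRp, R.inner_map_map]
    simp only [h1, h2]
  have hpos : 0 < Module.finrank ℝ E :=
    Module.finrank_pos_iff_exists_ne_zero.2 ⟨p, fun h => by simp [h] at hp⟩
  let i₀ : Fin (Module.finrank ℝ E) := ⟨0, hpos⟩
  obtain ⟨b, hb⟩ := Orthonormal.exists_orthonormalBasis_extension_of_card_eq
    (𝕜 := ℝ) (E := E) (ι := Fin (Module.finrank ℝ E)) (by simp) (v := fun _ => p) (s := {i₀})
    (by
      rw [orthonormal_iff_ite]
      rintro ⟨i, hi⟩ ⟨j, hj⟩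
      obtain rfl : i = i₀ := hi
      obtain rfl : j = i₀ := hj
      simp [Set.domRestrict, hp])
  have hb0 : b i₀ = p := hb i₀ rfl
  have hsum : ∀ x : Metric.sphere (0 : E) 1, 1 - ⟪p, (x : E)⟫_ℝ ^ 2 =
      ∑ i ∈ Finset.univ.erase i₀, ⟪b i, (x : E)⟫_ℝ ^ 2 := fun x => by
    have h1 := b.sum_sq_norm_inner_right (x : E)
    rw [norm_eq_of_mem_sphere x, ← Finset.add_sum_erase _ _ (Finset.mem_univ i₀), hb0] at h1
    simp only [Real.norm_eq_abs, sq_abs] at h1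
    linarith
  simp only [hsum, Finset.sum_mul]
  rw [integral_finsetSum _ fun i _ => integrable_toSphere_of_continuous (by exact .mul (by fun_prop) hwp),
    Finset.sum_congr rfl fun i hi => hsymm (b i) (b.norm_eq_one i) (by
      rw [← hb0]
      exact b.orthonormal.2 (Finset.ne_of_mem_erase hi).symm)]
  rw [Finset.sum_const, Finset.card_erase_of_mem (Finset.mem_univ _), nsmul_eq_mul,
    Finset.card_univ, Fintype.card_fin, Nat.cast_sub hpos, Nat.cast_one]

/-- Integration by parts for zonal functions on the sphere. -/
theorem integral_toSphere_zonal_by_parts {p e : E} (hp : ‖p‖ = 1) (he : ‖e‖ = 1)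
    (hpe : ⟪p, e⟫_ℝ = 0) {g g' : ℝ → ℝ} (hg : ∀ t ∈ Set.Icc (-1 : ℝ) 1, HasDerivAt g (g' t) t)
    (hg' : ContinuousOn g' (Set.Icc (-1) 1)) :
    ∫ x : Metric.sphere (0 : E) 1, (1 - ⟪p, (x : E)⟫_ℝ ^ 2) * g' ⟪p, (x : E)⟫_ℝ -
        ((Module.finrank ℝ E : ℝ) - 1) * (⟪p, (x : E)⟫_ℝ * g ⟪p, (x : E)⟫_ℝ)
        ∂(volume : Measure E).toSphere = 0 := by
  have hgc : ContinuousOn g (Set.Icc (-1) 1) := fun t ht => (hg t ht).continuousAt.continuousWithinAt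
  have hgp : Continuous fun x : Metric.sphere (0 : E) 1 => g ⟪p, (x : E)⟫_ℝ :=
    hgc.comp_continuous (by fun_prop) fun x => inner_mem_Icc_of_mem_sphere hp x
  have hgp' : Continuous fun x : Metric.sphere (0 : E) 1 => g' ⟪p, (x : E)⟫_ℝ :=
    hg'.comp_continuous (by fun_prop) fun x => inner_mem_Icc_of_mem_sphere hp x
  rw [integral_sub (integrable_toSphere_of_continuous (by exact .mul (by fun_prop) hgp'))
    (integrable_toSphere_of_continuous (by exact .mul continuous_const (.mul (by fun_prop) hgp))), integral_const_mul,
    ← integral_toSphere_inner_sq_mul_zonal hp he hpe hg',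
    integral_toSphere_inner_sq_mul_deriv hp he hpe hg hg', sub_self]

end Sphere

theorem one_add_sq_sub_two_mul_pos {σ t : ℝ} (hσ : σ ∈ Set.Ioo (-1 : ℝ) 1)
    (ht : t ∈ Set.Icc (-1 : ℝ) 1) : 0 < 1 + σ ^ 2 - 2 * σ * t := by
  obtain ⟨h1, h2⟩ := hσ
  obtain ⟨h3, h4⟩ := ht
  rcases le_total 0 σ with h | h
  · nlinarith [mul_nonneg h (sub_nonneg.2 h4), mul_pos (sub_pos.2 h2) (sub_pos.2 h2)]
  · nlinarith [mul_nonneg (neg_nonneg.2 h) (by linarith : 0 ≤ t + 1),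
      mul_pos (by linarith : 0 < 1 + σ) (by linarith : 0 < 1 + σ)]

theorem eq_of_hasDerivAt_zero {f f' : ℝ → ℝ} {a b : ℝ} (hab : a ≤ b)
    (hf : ∀ x ∈ Set.Icc a b, HasDerivAt f (f' x) x) (hf' : ∀ x ∈ Set.Ioo a b, f' x = 0) :
    f b = f a := by
  rcases hab.eq_or_lt with rfl | h
  · rfl
  obtain ⟨c, hc, hs⟩ := exists_hasDerivAt_eq_slope f f' h
    (fun x hx => (hf x hx).continuousAt.continuousWithinAt)
    (fun x hx => hf x (Set.Ioo_subset_Icc_self hx))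
  rw [hf' c hc, eq_div_iff (sub_pos.2 h).ne'] at hs
  linarith

section Sphere

variable {E : Type*} [NormedAddCommGroup E] [InnerProductSpace ℝ E]

/-- The squared distance of the point `x` of the unit sphere to `σ • p`, for a unit vector `p`. -/
noncomputable def poissonDist (p : E) (σ : ℝ) (x : Metric.sphere (0 : E) 1) : ℝ :=
  1 + σ ^ 2 - 2 * σ * ⟪p, (x : E)⟫_ℝ

theorem poissonDist_pos {p : E} (hp : ‖p‖ = 1) {σ : ℝ} (hσ : σ ∈ Set.Ioo (-1 : ℝ) 1)
    (x : Metric.sphere (0 : E) 1) : 0 < poissonDist p σ x :=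
  one_add_sq_sub_two_mul_pos hσ (inner_mem_Icc_of_mem_sphere hp x)

theorem continuous_poissonDist (p : E) :
    Continuous fun z : ℝ × Metric.sphere (0 : E) 1 => poissonDist p z.1 z.2 := by
  unfold poissonDist; fun_prop

theorem continuous_poissonDist_zpow {p : E} (hp : ‖p‖ = 1) {σ : ℝ}
    (hσ : σ ∈ Set.Ioo (-1 : ℝ) 1) (z : ℤ) : Continuous fun x => poissonDist p σ x ^ z :=
  Continuous.zpow₀ (by unfold poissonDist; fun_prop) z
    fun x => .inl (poissonDist_pos hp hσ x).ne'

variable [FiniteDimensional ℝ E] [MeasurableSpace E] [BorelSpace E]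

theorem hasDerivAt_integral_poissonDist_zpow {p : E} (hp : ‖p‖ = 1) {σ : ℝ}
    (hσ : σ ∈ Set.Ioo (-1 : ℝ) 1) (z : ℤ) :
    HasDerivAt (fun σ => ∫ x, poissonDist p σ x ^ z ∂(volume : Measure E).toSphere)
      (∫ x, z * poissonDist p σ x ^ (z - 1) * (2 * σ - 2 * ⟪p, (x : E)⟫_ℝ)
        ∂(volume : Measure E).toSphere) σ := by
  have hc : ∀ z : ℤ, ContinuousOn (fun y : ℝ × Metric.sphere (0 : E) 1 =>
      poissonDist p y.1 y.2 ^ z) (Set.Ioo (-1 : ℝ) 1 ×ˢ Set.univ) := fun z =>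
    (continuous_poissonDist p).continuousOn.zpow₀ z fun y hy => .inl (poissonDist_pos hp hy.1 _).ne'
  refine hasDerivAt_integral_of_compactSpace (F := fun σ x => poissonDist p σ x ^ z)
    (F' := fun σ x => z * poissonDist p σ x ^ (z - 1) * (2 * σ - 2 * ⟪p, (x : E)⟫_ℝ))
    isOpen_Ioo hσ (hc z) ?_ ?_
  · exact (continuousOn_const.mul (hc (z - 1))).mul (by fun_prop)
  · intro x y hy
    have h : HasDerivAt (fun y => poissonDist p y x) (2 * y - 2 * ⟪p, (x : E)⟫_ℝ) y := by
      have h1 := (((hasDerivAt_id y).pow 2).const_add 1).sub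
        (((hasDerivAt_id y).const_mul 2).mul_const ⟪p, (x : E)⟫_ℝ)
      exact h1.congr_deriv (by simp)
    exact (hasDerivAt_zpow z _ (.inl (poissonDist_pos hp hy x).ne')).comp y h

/-- Integration by parts applied to the powers of `poissonDist`. -/
theorem integral_poissonDist_by_parts {p e : E} (hp : ‖p‖ = 1) (he : ‖e‖ = 1)
    (hpe : ⟪p, e⟫_ℝ = 0) {σ : ℝ} (hσ : σ ∈ Set.Ioo (-1 : ℝ) 1) (z : ℤ) :
    ∫ x : Metric.sphere (0 : E) 1,
        (1 - ⟪p, (x : E)⟫_ℝ ^ 2) * (z * poissonDist p σ x ^ (z - 1) * (-2 * σ)) -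
        ((Module.finrank ℝ E : ℝ) - 1) * (⟪p, (x : E)⟫_ℝ * poissonDist p σ x ^ z)
        ∂(volume : Measure E).toSphere = 0 := by
  refine integral_toSphere_zonal_by_parts hp he hpe (g := fun t => (1 + σ ^ 2 - 2 * σ * t) ^ z)
    (g' := fun t => z * (1 + σ ^ 2 - 2 * σ * t) ^ (z - 1) * (-2 * σ)) ?_ ?_
  · intro t ht
    have h : HasDerivAt (fun t => 1 + σ ^ 2 - 2 * σ * t) (-2 * σ) t := by
      have h1 := ((hasDerivAt_id t).const_mul (2 * σ)).const_sub (1 + σ ^ 2)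
      exact h1.congr_deriv (by simp)
    exact (hasDerivAt_zpow z _ (.inl (one_add_sq_sub_two_mul_pos hσ ht).ne')).comp t h
  · refine (continuousOn_const.mul (ContinuousOn.zpow₀ (by fun_prop) _ ?_)).mul continuousOn_const
    exact fun t ht => .inl (one_add_sq_sub_two_mul_pos hσ ht).ne'

/-- In even dimension `2 * (k + 1)`, the mean values of the Poisson kernel and of the Newton
kernel. -/
theorem integral_poissonDist_zpow {p e : E} (hp : ‖p‖ = 1) (he : ‖e‖ = 1)
    (hpe : ⟪p, e⟫_ℝ = 0) {k : ℕ} (hk : Module.finrank ℝ E = 2 * (k + 1)) {σ : ℝ} (hσ0 : 0 ≤ σ)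
    (hσ1 : σ < 1) :
    (1 - σ ^ 2) * ∫ x, poissonDist p σ x ^ (-(k + 1 : ℤ)) ∂(volume : Measure E).toSphere =
        (volume : Measure E).toSphere.real Set.univ ∧
      ∫ x, poissonDist p σ x ^ (-(k : ℤ)) ∂(volume : Measure E).toSphere =
        (volume : Measure E).toSphere.real Set.univ := by
  set ν := (volume : Measure E).toSphere
  have hmem : ∀ y ∈ Set.Icc 0 σ, y ∈ Set.Ioo (-1 : ℝ) 1 := fun y hy =>
    ⟨by linarith [hy.1], by linarith [hy.2]⟩
  let v : ℝ → ℝ := fun σ => ∫ x, poissonDist p σ x ^ (-(k : ℤ)) ∂ν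
  let v' : ℝ → ℝ := fun σ => ∫ x, ((-(k : ℤ) : ℤ) : ℝ) * poissonDist p σ x ^ (-(k : ℤ) - 1) *
    (2 * σ - 2 * ⟪p, (x : E)⟫_ℝ) ∂ν
  let a : ℝ → ℝ := fun σ => ∫ x, poissonDist p σ x ^ (-(k + 1 : ℤ)) ∂ν
  let a' : ℝ → ℝ := fun σ => ∫ x, ((-(k + 1 : ℤ) : ℤ) : ℝ) *
    poissonDist p σ x ^ (-(k + 1 : ℤ) - 1) * (2 * σ - 2 * ⟪p, (x : E)⟫_ℝ) ∂ν
  have hv : ∀ y ∈ Set.Icc 0 σ, HasDerivAt v (v' y) y := fun y hy =>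
    hasDerivAt_integral_poissonDist_zpow hp (hmem y hy) _
  have ha : ∀ y ∈ Set.Icc 0 σ, HasDerivAt a (a' y) y := fun y hy =>
    hasDerivAt_integral_poissonDist_zpow hp (hmem y hy) _
  let u : ℝ → ℝ := fun σ => (1 - σ ^ 2) * a σ
  let u' : ℝ → ℝ := fun σ => -(2 * σ) * a σ + (1 - σ ^ 2) * a' σ
  have hu : ∀ y ∈ Set.Icc 0 σ, HasDerivAt u (u' y) y := fun y hy => by
    have h1 : HasDerivAt (fun σ : ℝ => 1 - σ ^ 2) (-(2 * y)) y := by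
      simpa using ((hasDerivAt_id y).pow 2).const_sub 1
    exact h1.mul (ha y hy)
  have hint : ∀ y ∈ Set.Icc 0 σ, ∀ z : ℤ, ∀ f : Metric.sphere (0 : E) 1 → ℝ, Continuous f →
      Integrable (fun x => f x * poissonDist p y x ^ z) ν := fun y hy z f hf =>
    integrable_toSphere_of_continuous (hf.mul (continuous_poissonDist_zpow hp (hmem y hy) z))
  have e1 : ∀ y ∈ Set.Icc 0 σ, y * v' y = -k * (v y - u y) := by
    intro y hy
    have h1 : u y = ∫ x, (1 - y ^ 2) * poissonDist p y x ^ (-(k + 1 : ℤ)) ∂ν :=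
      (integral_const_mul _ _).symm
    have h2 : v y - u y = ∫ x, 1 * poissonDist p y x ^ (-(k : ℤ)) -
        (1 - y ^ 2) * poissonDist p y x ^ (-(k + 1 : ℤ)) ∂ν := by
      rw [integral_sub (hint y hy _ _ continuous_const) (hint y hy _ _ continuous_const), h1]
      simp [v]
    rw [h2, ← integral_const_mul, ← integral_const_mul]
    congr 1
    funext x
    have hq := poissonDist_pos hp (hmem y hy) x
    have hz : poissonDist p y x ^ (-(k : ℤ)) =
        poissonDist p y x * poissonDist p y x ^ (-(k + 1 : ℤ)) := by
      rw [← zpow_one_add₀ hq.ne']; congr 1; ring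
    rw [hz, show -(k : ℤ) - 1 = -(k + 1 : ℤ) by ring]
    simp only [poissonDist]
    push_cast
    ring
  have e2 : ∀ y ∈ Set.Icc 0 σ, y * u' y = k * (v y - u y) := by
    intro y hy
    have hI : ∀ z : ℤ, ∀ f : Metric.sphere (0 : E) 1 → ℝ, Continuous f →
      Integrable (fun x => f x * poissonDist p y x ^ z) ν := hint y hy
    have hbp := integral_poissonDist_by_parts hp he hpe (hmem y hy) (-(k + 1 : ℤ))
    have h1 : y * u' y - k * (v y - u y) = ∫ x,
        (((-(2 * y ^ 2) + k * (1 - y ^ 2)) * poissonDist p y x ^ (-(k + 1 : ℤ)) +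
        (y * (1 - y ^ 2) * ((-(k + 1 : ℤ) : ℤ) : ℝ) * (2 * y - 2 * ⟪p, (x : E)⟫_ℝ)) *
          poissonDist p y x ^ (-(k + 1 : ℤ) - 1)) - k * poissonDist p y x ^ (-(k : ℤ))) ∂ν := by
      have i1 := hI (-(k + 1 : ℤ)) (fun _ => -(2 * y ^ 2) + k * (1 - y ^ 2)) continuous_const
      have i2 := hI (-(k + 1 : ℤ) - 1) (fun x => y * (1 - y ^ 2) * ((-(k + 1 : ℤ) : ℤ) : ℝ) *
        (2 * y - 2 * ⟪p, (x : E)⟫_ℝ)) (by fun_prop)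
      have i3 := hI (-(k : ℤ)) (fun _ => (k : ℝ)) continuous_const
      rw [integral_sub (by exact i1.add i2) i3, integral_add i1 i2, integral_const_mul,
        integral_const_mul]
      have h3 : ∫ x : Metric.sphere (0 : E) 1, (y * (1 - y ^ 2) * ((-(k + 1 : ℤ) : ℤ) : ℝ) *
          (2 * y - 2 * ⟪p, (x : E)⟫_ℝ)) * poissonDist p y x ^ (-(k + 1 : ℤ) - 1) ∂ν =
          y * (1 - y ^ 2) * a' y := by
        rw [← integral_const_mul]
        congr 1
        funext x
        ring
      rw [h3]
      simp only [u', u, v, a]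
      ring
    have h2 : y * u' y - k * (v y - u y) = -(2 * y) * 0 := by
      rw [h1, ← hbp, ← integral_const_mul]
      congr 1
      funext x
      have hq := poissonDist_pos hp (hmem y hy) x
      have hz : poissonDist p y x ^ (-(k : ℤ)) =
          poissonDist p y x ^ 2 * poissonDist p y x ^ (-(k + 1 : ℤ) - 1) := by
        rw [← zpow_natCast, ← zpow_add₀ hq.ne']; congr 1; push_cast; ring
      have hz' : poissonDist p y x ^ (-(k + 1 : ℤ)) =
          poissonDist p y x * poissonDist p y x ^ (-(k + 1 : ℤ) - 1) := by
        rw [← zpow_one_add₀ hq.ne']; ring_nf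
      rw [hz, hz', hk]
      generalize poissonDist p y x ^ (-(k + 1 : ℤ) - 1) = w
      simp only [poissonDist]
      push_cast
      ring
    linarith
  have hpd0 : ∀ x, poissonDist p 0 x = 1 := fun x => by simp [poissonDist]
  have hv0 : v 0 = ν.real Set.univ := by simp [v, hpd0]
  have hu0 : u 0 = ν.real Set.univ := by simp [u, a, hpd0]
  have hadd : u σ + v σ = u 0 + v 0 :=
    eq_of_hasDerivAt_zero (f := fun y => u y + v y) (f' := fun y => u' y + v' y) hσ0
      (fun y hy => (hu y hy).add (hv y hy)) fun y hy => by
        have hy' := Set.Ioo_subset_Icc_self hy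
        apply mul_left_cancel₀ hy.1.ne'
        linear_combination e1 y hy' + e2 y hy'
  have hsub : σ ^ (2 * k) * (u σ - v σ) = 0 ^ (2 * k) * (u 0 - v 0) :=
    eq_of_hasDerivAt_zero (f := fun y => y ^ (2 * k) * (u y - v y))
      (f' := fun y => ((2 * k : ℕ) : ℝ) * y ^ (2 * k - 1) * (u y - v y) +
        y ^ (2 * k) * (u' y - v' y)) hσ0
      (fun y hy => (hasDerivAt_pow _ y).mul ((hu y hy).sub (hv y hy))) fun y hy => by
        have hy' := Set.Ioo_subset_Icc_self hy
        apply mul_left_cancel₀ hy.1.ne'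
        have hpow : (k : ℝ) * (y * y ^ (2 * k - 1)) = k * y ^ (2 * k) := by
          rcases Nat.eq_zero_or_pos k with rfl | hk0
          · simp
          · rw [← pow_succ']; congr 2; omega
        push_cast
        linear_combination 2 * (u y - v y) * hpow + y ^ (2 * k) * (e2 y hy' - e1 y hy')
  have huv : u σ = v σ := by
    rcases hσ0.eq_or_lt with rfl | h
    · rw [hu0, hv0]
    · rw [hu0, hv0, sub_self, mul_zero] at hsub
      have := (mul_eq_zero.1 hsub).resolve_left (pow_pos h _).ne'
      linarith
  constructor
  · change u σ = _
    linarith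
  · change v σ = _
    linarith

/-- The second moment of the Poisson kernel along its axis. -/
theorem integral_inner_sq_mul_poissonDist_zpow {p e : E} (hp : ‖p‖ = 1) (he : ‖e‖ = 1)
    (hpe : ⟪p, e⟫_ℝ = 0) {k : ℕ} (hk : Module.finrank ℝ E = 2 * (k + 1)) {σ : ℝ} (hσ0 : 0 ≤ σ)
    (hσ1 : σ < 1) :
    (1 - σ ^ 2) * ∫ x : Metric.sphere (0 : E) 1,
        ⟪p, (x : E)⟫_ℝ ^ 2 * poissonDist p σ x ^ (-(k + 1 : ℤ)) ∂(volume : Measure E).toSphere =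
      (volume : Measure E).toSphere.real Set.univ *
        ((1 + (2 * k + 1) * σ ^ 2) / (2 * (k + 1))) := by
  set ν := (volume : Measure E).toSphere
  have hσ : σ ∈ Set.Ioo (-1 : ℝ) 1 := ⟨by linarith, hσ1⟩
  have hint : ∀ z : ℤ, ∀ f : Metric.sphere (0 : E) 1 → ℝ, Continuous f →
      Integrable (fun x => f x * poissonDist p σ x ^ z) ν := fun z f hf =>
    integrable_toSphere_of_continuous (hf.mul (continuous_poissonDist_zpow hp hσ z))
  rcases hσ0.eq_or_lt with rfl | hpos
  · have h := integral_toSphere_zonal_by_parts hp he hpe (g := fun t => t) (g' := fun _ => 1)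
      (fun t _ => hasDerivAt_id t) continuousOn_const
    have hs : Integrable (fun x : Metric.sphere (0 : E) 1 => ⟪p, (x : E)⟫_ℝ ^ 2) ν :=
      integrable_toSphere_of_continuous (by fun_prop)
    have h' : ∫ x : Metric.sphere (0 : E) 1, 1 - (2 * (k + 1) : ℝ) * ⟪p, (x : E)⟫_ℝ ^ 2 ∂ν = 0 := by
      rw [← h]
      congr 1
      funext x
      rw [hk]
      push_cast
      ring
    rw [integral_sub (integrable_const _) (hs.const_mul _), integral_const_mul] at h'
    simp only [integral_const, smul_eq_mul, mul_one] at h'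
    have hk0 : (2 * (k + 1) : ℝ) ≠ 0 := by positivity
    simp only [poissonDist]
    simp
    field_simp
    linarith
  · obtain ⟨hu, hv⟩ := integral_poissonDist_zpow hp he hpe hk hσ0 hσ1
    have hbp := integral_poissonDist_by_parts hp he hpe hσ (-(k : ℤ))
    set M0 := ∫ x, poissonDist p σ x ^ (-(k + 1 : ℤ)) ∂ν with hM0
    set M1 := ∫ x : Metric.sphere (0 : E) 1,
      ⟪p, (x : E)⟫_ℝ * poissonDist p σ x ^ (-(k + 1 : ℤ)) ∂ν with hM1
    set M2 := ∫ x : Metric.sphere (0 : E) 1,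
      ⟪p, (x : E)⟫_ℝ ^ 2 * poissonDist p σ x ^ (-(k + 1 : ℤ)) ∂ν with hM2
    have i0 : Integrable (fun x => poissonDist p σ x ^ (-(k + 1 : ℤ))) ν := by
      simpa using hint (-(k + 1 : ℤ)) (fun _ => 1) continuous_const
    have i1 := hint (-(k + 1 : ℤ)) (fun x => ⟪p, (x : E)⟫_ℝ) (by fun_prop)
    have i2 := hint (-(k + 1 : ℤ)) (fun x => ⟪p, (x : E)⟫_ℝ ^ 2) (by fun_prop)
    have hz : ∀ x, poissonDist p σ x ^ (-(k : ℤ)) =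
        poissonDist p σ x * poissonDist p σ x ^ (-(k + 1 : ℤ)) := fun x => by
      rw [← zpow_one_add₀ (poissonDist_pos hp hσ x).ne']; congr 1; ring
    have h1 : (1 + σ ^ 2) * M0 - 2 * σ * M1 = ν.real Set.univ := by
      rw [← hv, hM0, hM1, ← integral_const_mul, ← integral_const_mul,
        ← integral_sub (i0.const_mul _) (i1.const_mul _)]
      congr 1
      funext x
      rw [hz]
      generalize poissonDist p σ x ^ (-(k + 1 : ℤ)) = w
      simp only [poissonDist]
      ring
    have h2 : 2 * σ * k * M0 - (2 * k + 1) * (1 + σ ^ 2) * M1 + 2 * σ * (k + 1) * M2 = 0 := by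
      rw [← hbp, hM0, hM1, hM2, ← integral_const_mul, ← integral_const_mul, ← integral_const_mul,
        ← integral_sub (i0.const_mul _) (i1.const_mul _),
        ← integral_add (by exact (i0.const_mul _).sub (i1.const_mul _)) (i2.const_mul _)]
      congr 1
      funext x
      rw [hz, show -(k : ℤ) - 1 = -(k + 1 : ℤ) by ring, hk]
      generalize poissonDist p σ x ^ (-(k + 1 : ℤ)) = w
      simp only [poissonDist]
      push_cast
      ring
    have h3 : (1 - σ ^ 2) * M1 = σ * ν.real Set.univ := by
      apply mul_left_cancel₀ hpos.ne'
      linear_combination (1 + σ ^ 2) / 2 * hu - (1 - σ ^ 2) / 2 * h1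
    have hk0 : (2 * (k + 1) : ℝ) ≠ 0 := by positivity
    rw [mul_div_assoc', eq_div_iff hk0]
    apply mul_left_cancel₀ hpos.ne'
    linear_combination (1 - σ ^ 2) * h2 - 2 * σ * k * hu + (2 * k + 1) * (1 + σ ^ 2) * h3

/-- The second moment of the Poisson kernel in a direction orthogonal to its axis. -/
theorem integral_inner_sq_mul_poissonDist_zpow_of_orthogonal {p e : E} (hp : ‖p‖ = 1)
    (he : ‖e‖ = 1) (hpe : ⟪p, e⟫_ℝ = 0) {k : ℕ} (hk : Module.finrank ℝ E = 2 * (k + 1)) {σ : ℝ}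
    (hσ0 : 0 ≤ σ) (hσ1 : σ < 1) :
    (1 - σ ^ 2) * ∫ x : Metric.sphere (0 : E) 1,
        ⟪e, (x : E)⟫_ℝ ^ 2 * poissonDist p σ x ^ (-(k + 1 : ℤ)) ∂(volume : Measure E).toSphere =
      (volume : Measure E).toSphere.real Set.univ * ((1 - σ ^ 2) / (2 * (k + 1))) := by
  have hσ : σ ∈ Set.Ioo (-1 : ℝ) 1 := ⟨by linarith, hσ1⟩
  have h : _ = ∫ x : Metric.sphere (0 : E) 1, (1 - ⟪p, (x : E)⟫_ℝ ^ 2) *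
      poissonDist p σ x ^ (-(k + 1 : ℤ)) ∂(volume : Measure E).toSphere :=
    integral_toSphere_inner_sq_mul_zonal hp he hpe
      (w := fun t => (1 + σ ^ 2 - 2 * σ * t) ^ (-(k + 1 : ℤ)))
      (ContinuousOn.zpow₀ (by fun_prop) _ fun t ht => .inl (one_add_sq_sub_two_mul_pos hσ ht).ne')
  change _ * ∫ x : Metric.sphere (0 : E) 1, ⟪e, (x : E)⟫_ℝ ^ 2 *
    poissonDist p σ x ^ (-(k + 1 : ℤ)) ∂(volume : Measure E).toSphere = _ at h
  have hc := continuous_poissonDist_zpow hp hσ (-(k + 1 : ℤ))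
  have h1 := (integral_poissonDist_zpow hp he hpe hk hσ0 hσ1).1
  have h2 := integral_inner_sq_mul_poissonDist_zpow hp he hpe hk hσ0 hσ1
  simp only [sub_mul, one_mul] at h
  rw [integral_sub (integrable_toSphere_of_continuous hc)
    (integrable_toSphere_of_continuous (by exact .mul (by fun_prop) hc)), hk] at h
  push_cast at h
  have hk1 : (2 * k + 1 : ℝ) ≠ 0 := by positivity
  have hk0 : (2 * (k + 1) : ℝ) ≠ 0 := by positivity
  rw [mul_div_assoc', eq_div_iff hk0] at h2 ⊢
  apply mul_left_cancel₀ hk1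
  linear_combination (1 - σ ^ 2) * (2 * (k + 1)) * h + 2 * (k + 1) * h1 - h2

end Sphere

section Qubits

variable {k : ℕ}

theorem finrank_real_qubits (k : ℕ) : Module.finrank ℝ (Qubits k) = 2 * 2 ^ k := by
  rw [(WithLp.linearEquiv 2 ℝ (Fin (2 ^ k) → ℂ)).finrank_eq, Module.finrank_pi_fintype]
  simp [mul_comm]

theorem real_inner_eq_re_inner_qubits (x y : Qubits k) : ⟪x, y⟫_ℝ = (⟪x, y⟫_ℂ).re := by
  simp [PiLp.inner_apply, Complex.inner]

theorem norm_inner_sq_eq_real_inner_sq (x y : Qubits k) :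
    ‖⟪x, y⟫_ℂ‖ ^ 2 = ⟪y, x⟫_ℝ ^ 2 + ⟪Complex.I • y, x⟫_ℝ ^ 2 := by
  rw [norm_inner_symm, real_inner_eq_re_inner_qubits, real_inner_eq_re_inner_qubits,
    inner_smul_left, Complex.sq_norm, Complex.normSq_apply]
  simp
  ring

theorem exists_two_pow_eq_succ (k : ℕ) : ∃ K : ℕ, 2 ^ k = K + 1 :=
  ⟨2 ^ k - 1, (Nat.sub_add_cancel Nat.one_le_two_pow).symm⟩

/-- The constant of `normalDensity` is the inverse of the area of the sphere. -/
theorem doubleFactorial_div_mul_area {K : ℕ} (hK : 2 ^ k = K + 1) :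
    (((2 * 2 ^ k - 2)‼ : ℕ) : ℝ) / (2 * Real.pi) ^ (2 ^ k) *
      (volume : Measure (Qubits k)).toSphere.real Set.univ = 1 := by
  have : Nontrivial (Qubits k) := Module.nontrivial_of_finrank_pos (R := ℝ)
    (by rw [finrank_real_qubits]; positivity)
  rw [Measure.toSphere_real_apply_univ, measureReal_def,
    InnerProductSpace.volume_ball_of_dim_even (finrank_real_qubits k), finrank_real_qubits, hK,
    show 2 * (K + 1) - 2 = 2 * K by omega, Nat.doubleFactorial_two_mul, ENNReal.ofReal_one, one_pow,
    one_mul, ENNReal.toReal_ofReal (by positivity), Nat.factorial_succ]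
  push_cast
  have := Real.pi_pos
  field_simp
  rw [mul_pow, pow_succ 2 K]

variable {Φ : Qubits k}

theorem normalDensity_angle (hΦ : ‖Φ‖ = 1) {K : ℕ} (hK : 2 ^ k = K + 1) (σ : ℝ)
    (x : Metric.sphere (0 : Qubits k) 1) :
    normalDensity (2 ^ k) σ (InnerProductGeometry.angle Φ (x : Qubits k)) =
      (((2 * 2 ^ k - 2)‼ : ℕ) : ℝ) / (2 * Real.pi) ^ (2 ^ k) *
        ((1 - σ ^ 2) * poissonDist Φ σ x ^ (-(K + 1 : ℤ))) := by
  rw [normalDensity, InnerProductGeometry.cos_angle, hΦ, norm_eq_of_mem_sphere x, mul_one, div_one,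
    zpow_neg, div_eq_mul_inv (1 - σ ^ 2), show (K + 1 : ℤ) = ((2 ^ k : ℕ) : ℤ) by rw [hK]; simp,
    zpow_natCast, poissonDist]

theorem continuous_normalDensity_angle (hΦ : ‖Φ‖ = 1) {σ : ℝ} (hσ : σ ∈ Set.Ioo (-1 : ℝ) 1) :
    Continuous fun x : Metric.sphere (0 : Qubits k) 1 =>
      normalDensity (2 ^ k) σ (InnerProductGeometry.angle Φ (x : Qubits k)) := by
  obtain ⟨K, hK⟩ := exists_two_pow_eq_succ k
  simp only [normalDensity_angle hΦ hK]
  exact continuous_const.mul (continuous_const.mul (continuous_poissonDist_zpow hΦ hσ _))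

theorem normalDensity_angle_nonneg (hΦ : ‖Φ‖ = 1) {σ : ℝ} (hσ : σ ∈ Set.Ioo (-1 : ℝ) 1)
    (x : Metric.sphere (0 : Qubits k) 1) :
    0 ≤ normalDensity (2 ^ k) σ (InnerProductGeometry.angle Φ (x : Qubits k)) := by
  obtain ⟨K, hK⟩ := exists_two_pow_eq_succ k
  rw [normalDensity_angle hΦ hK]
  have h1 := (poissonDist_pos hΦ hσ x).le
  have h2 : 0 ≤ 1 - σ ^ 2 := by nlinarith [hσ.1, hσ.2]
  positivity

theorem norm_I_smul_qubits (hΦ : ‖Φ‖ = 1) : ‖Complex.I • Φ‖ = 1 := by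
  rw [norm_smul, Complex.norm_I, one_mul, hΦ]

theorem real_inner_I_smul_qubits (Φ : Qubits k) : ⟪Φ, Complex.I • Φ⟫_ℝ = 0 := by
  rw [real_inner_eq_re_inner_qubits, inner_smul_right, Complex.I_mul_re, neg_eq_zero]
  exact inner_self_im (𝕜 := ℂ) Φ

theorem isProbabilityMeasure_normalLaw (hΦ : ‖Φ‖ = 1) {σ : ℝ} (hσ0 : 0 ≤ σ) (hσ1 : σ < 1) :
    IsProbabilityMeasure (normalLaw Φ σ) := by
  obtain ⟨K, hK⟩ := exists_two_pow_eq_succ k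
  have hσ : σ ∈ Set.Ioo (-1 : ℝ) 1 := ⟨by linarith, hσ1⟩
  refine ⟨?_⟩
  rw [normalLaw, Measure.map_apply measurable_subtype_coe .univ, Set.preimage_univ,
    withDensity_apply _ .univ, Measure.restrict_univ, ← ofReal_integral_eq_lintegral_ofReal
      (integrable_toSphere_of_continuous (continuous_normalDensity_angle hΦ hσ))
      (Filter.Eventually.of_forall (normalDensity_angle_nonneg hΦ hσ))]
  simp only [normalDensity_angle hΦ hK]
  rw [integral_const_mul, integral_const_mul, (integral_poissonDist_zpow hΦ (norm_I_smul_qubits hΦ)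
    (real_inner_I_smul_qubits Φ) ((finrank_real_qubits k).trans (by rw [hK])) hσ0 hσ1).1,
    doubleFactorial_div_mul_area hK, ENNReal.ofReal_one]

theorem integral_normalLaw (hΦ : ‖Φ‖ = 1) {σ : ℝ} (hσ : σ ∈ Set.Ioo (-1 : ℝ) 1) {K : ℕ}
    (hK : 2 ^ k = K + 1) {f : Qubits k → ℝ} (hf : Continuous f) :
    ∫ ψ, f ψ ∂normalLaw Φ σ = (((2 * 2 ^ k - 2)‼ : ℕ) : ℝ) / (2 * Real.pi) ^ (2 ^ k) *
      ((1 - σ ^ 2) * ∫ x : Metric.sphere (0 : Qubits k) 1,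
        f x * poissonDist Φ σ x ^ (-(K + 1 : ℤ)) ∂(volume : Measure (Qubits k)).toSphere) := by
  rw [normalLaw, integral_map measurable_subtype_coe.aemeasurable hf.aestronglyMeasurable,
    integral_withDensity_eq_integral_toReal_smul
      (continuous_normalDensity_angle hΦ hσ).measurable.ennreal_ofReal
      (Filter.Eventually.of_forall fun _ => ENNReal.ofReal_lt_top),
    ← integral_const_mul, ← integral_const_mul]
  congr 1
  funext x
  rw [ENNReal.toReal_ofReal (normalDensity_angle_nonneg hΦ hσ x), normalDensity_angle hΦ hK,
    smul_eq_mul]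
  ring

theorem integral_normalLaw_norm_inner_sq_split (hΦ : ‖Φ‖ = 1) {σ : ℝ}
    (hσ : σ ∈ Set.Ioo (-1 : ℝ) 1) (w : Qubits k) :
    ∫ ψ, ‖⟪ψ, w⟫_ℂ‖ ^ 2 ∂normalLaw Φ σ =
      ∫ ψ, ⟪w, ψ⟫_ℝ ^ 2 ∂normalLaw Φ σ + ∫ ψ, ⟪Complex.I • w, ψ⟫_ℝ ^ 2 ∂normalLaw Φ σ := by
  obtain ⟨K, hK⟩ := exists_two_pow_eq_succ k
  have hc := continuous_poissonDist_zpow hΦ hσ (-(K + 1 : ℤ))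
  rw [integral_normalLaw hΦ hσ hK (by fun_prop), integral_normalLaw hΦ hσ hK (by fun_prop),
    integral_normalLaw hΦ hσ hK (by fun_prop), ← mul_add, ← mul_add, ← integral_add
      (integrable_toSphere_of_continuous (by exact .mul (by fun_prop) hc))
      (integrable_toSphere_of_continuous (by exact .mul (by fun_prop) hc))]
  simp only [norm_inner_sq_eq_real_inner_sq, add_mul]

theorem integral_normalLaw_inner_sq_of_orthogonal (hΦ : ‖Φ‖ = 1) {σ : ℝ} (hσ0 : 0 ≤ σ)
    (hσ1 : σ < 1) {e : Qubits k} (he : ‖e‖ = 1) (hΦe : ⟪Φ, e⟫_ℝ = 0) :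
    ∫ ψ, ⟪e, ψ⟫_ℝ ^ 2 ∂normalLaw Φ σ = (1 - σ ^ 2) / (2 * 2 ^ k) := by
  obtain ⟨K, hK⟩ := exists_two_pow_eq_succ k
  have hK' : (2 : ℝ) ^ k = K + 1 := mod_cast hK
  rw [integral_normalLaw hΦ ⟨by linarith, hσ1⟩ hK (by fun_prop),
    integral_inner_sq_mul_poissonDist_zpow_of_orthogonal hΦ he hΦe
      ((finrank_real_qubits k).trans (by rw [hK])) hσ0 hσ1, ← mul_assoc,
    doubleFactorial_div_mul_area hK, one_mul, hK']

theorem integral_normalLaw_inner_self_sq (hΦ : ‖Φ‖ = 1) {σ : ℝ} (hσ0 : 0 ≤ σ)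
    (hσ1 : σ < 1) :
    ∫ ψ, ⟪Φ, ψ⟫_ℝ ^ 2 ∂normalLaw Φ σ = (1 + (2 * 2 ^ k - 1) * σ ^ 2) / (2 * 2 ^ k) := by
  obtain ⟨K, hK⟩ := exists_two_pow_eq_succ k
  have hK' : (2 : ℝ) ^ k = K + 1 := mod_cast hK
  rw [integral_normalLaw hΦ ⟨by linarith, hσ1⟩ hK (by fun_prop),
    integral_inner_sq_mul_poissonDist_zpow hΦ (norm_I_smul_qubits hΦ) (real_inner_I_smul_qubits Φ)
      ((finrank_real_qubits k).trans (by rw [hK])) hσ0 hσ1, ← mul_assoc,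
    doubleFactorial_div_mul_area hK, one_mul, hK']
  ring

/-- The expected squared overlap with the centre of the normal distribution. -/
theorem integral_normalLaw_norm_inner_self_sq (hΦ : ‖Φ‖ = 1) {σ : ℝ} (hσ0 : 0 ≤ σ)
    (hσ1 : σ < 1) :
    ∫ ψ, ‖⟪ψ, Φ⟫_ℂ‖ ^ 2 ∂normalLaw Φ σ = (1 + (2 ^ k - 1) * σ ^ 2) / 2 ^ k := by
  rw [integral_normalLaw_norm_inner_sq_split hΦ ⟨by linarith, hσ1⟩,
    integral_normalLaw_inner_self_sq hΦ hσ0 hσ1, integral_normalLaw_inner_sq_of_orthogonal hΦ hσ0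
      hσ1 (norm_I_smul_qubits hΦ) (real_inner_I_smul_qubits Φ)]
  field_simp
  ring

/-- The expected squared overlap with a state orthogonal to the centre. -/
theorem integral_normalLaw_norm_inner_sq_of_orthogonal (hΦ : ‖Φ‖ = 1) {σ : ℝ} (hσ0 : 0 ≤ σ)
    (hσ1 : σ < 1) {w : Qubits k} (hw : ‖w‖ = 1) (hΦw : ⟪Φ, w⟫_ℂ = 0) :
    ∫ ψ, ‖⟪ψ, w⟫_ℂ‖ ^ 2 ∂normalLaw Φ σ = (1 - σ ^ 2) / 2 ^ k := by
  rw [integral_normalLaw_norm_inner_sq_split hΦ ⟨by linarith, hσ1⟩,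
    integral_normalLaw_inner_sq_of_orthogonal hΦ hσ0 hσ1 hw
      (by rw [real_inner_eq_re_inner_qubits, hΦw, Complex.zero_re]),
    integral_normalLaw_inner_sq_of_orthogonal hΦ hσ0 hσ1 (norm_I_smul_qubits hw)
      (by rw [real_inner_eq_re_inner_qubits, inner_smul_right, hΦw, mul_zero, Complex.zero_re])]
  field_simp
  ring

end Qubits

namespace QuantumCode

variable {n m : ℕ} (C : QuantumCode n m)

theorem continuous_project (s : Fin C.numErrors) : Continuous (C.project s) :=
  (C.syndromeSpace s).starProjection.continuous

theorem measurable_ofReal_norm_project_sq (s : Fin C.numErrors) :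
    Measurable fun ψ => ENNReal.ofReal (‖C.project s ψ‖ ^ 2) :=
  ((C.continuous_project s).norm.pow 2).measurable.ennreal_ofReal

theorem measurable_correct (s : Fin C.numErrors) : Measurable (C.correct s) := by
  have hp := (C.continuous_project s).measurable
  exact (C.error s).symm.continuous.measurable.comp
    ((Complex.measurable_ofReal.comp hp.norm.inv).smul hp)

theorem error_encode_mem_syndromeSpace (s : Fin C.numErrors) (u : Qubits m) :
    C.error s (C.encode u) ∈ C.syndromeSpace s :=
  Submodule.mem_map.2 ⟨C.encode u, LinearMap.mem_range.2 ⟨u, rfl⟩, rfl⟩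

/-- The overlap of the corrected state with an encoded state, weighted by the probability of the
syndrome. -/
theorem norm_project_sq_mul_norm_inner_correct_sq (s : Fin C.numErrors) (ψ : Qubits n)
    (u : Qubits m) :
    ‖C.project s ψ‖ ^ 2 * ‖⟪C.correct s ψ, C.encode u⟫_ℂ‖ ^ 2 =
      ‖⟪ψ, C.error s (C.encode u)⟫_ℂ‖ ^ 2 := by
  have h1 : ⟪ψ, C.error s (C.encode u)⟫_ℂ = ⟪C.project s ψ, C.error s (C.encode u)⟫_ℂ := by
    rw [project, Submodule.inner_starProjection_left_eq_right,
      Submodule.starProjection_eq_self_iff.2 (C.error_encode_mem_syndromeSpace s u)]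
  have h2 : ⟪C.correct s ψ, C.encode u⟫_ℂ =
      ((‖C.project s ψ‖⁻¹ : ℝ) : ℂ) * ⟪C.project s ψ, C.error s (C.encode u)⟫_ℂ := by
    rw [correct, ← (C.error s).inner_map_map, LinearIsometryEquiv.apply_symm_apply,
      inner_smul_left, Complex.conj_ofReal]
  rw [h1, h2, norm_mul, Complex.norm_real, norm_inv, norm_norm]
  rcases eq_or_ne (C.project s ψ) 0 with h | h
  · simp [h]
  · have := norm_ne_zero_iff.2 h
    field_simp

variable {C} {Ω : Type*} [MeasurableSpace Ω] {P : Measure Ω} {S : Ω → Fin C.numErrors}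
  {Ψ : Ω → Qubits n}

/-- The law of the disturbed state on the event that the syndrome `s` is measured. -/
theorem IsSyndromeOf.map_restrict (hS : C.IsSyndromeOf P S Ψ) (hΨ : AEMeasurable Ψ P)
    (s : Fin C.numErrors) :
    (P.restrict (S ⁻¹' {s})).map Ψ =
      (P.map Ψ).withDensity fun ψ => ENNReal.ofReal (‖C.project s ψ‖ ^ 2) := by
  ext B hB
  rw [Measure.map_apply_of_aemeasurable hΨ.restrict hB,
    Measure.restrict_apply' (hS.1 (measurableSet_singleton s)), Set.inter_comm, hS.2 s B hB,
    withDensity_apply _ hB, Measure.restrict_map_of_aemeasurable hΨ hB,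
    lintegral_map' (C.measurable_ofReal_norm_project_sq s).aemeasurable hΨ.restrict]

theorem norm_correct_le_one (C : QuantumCode n m) (s : Fin C.numErrors) (ψ : Qubits n) :
    ‖C.correct s ψ‖ ≤ 1 := by
  rw [correct, LinearIsometryEquiv.norm_map, norm_smul, Complex.norm_real, norm_inv, norm_norm]
  exact inv_mul_le_one

theorem integral_norm_inner_correct_sq [IsFiniteMeasure P] (hS : C.IsSyndromeOf P S Ψ)
    (hΨ : AEMeasurable Ψ P) (u : Qubits m) :
    ∫ ω, ‖⟪C.correct (S ω) (Ψ ω), C.encode u⟫_ℂ‖ ^ 2 ∂P =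
      ∑ s, ∫ ψ, ‖⟪ψ, C.error s (C.encode u)⟫_ℂ‖ ^ 2 ∂P.map Ψ := by
  have hmeas : ∀ s, MeasurableSet (S ⁻¹' {s}) := fun s => hS.1 (measurableSet_singleton s)
  have hg : ∀ s, Measurable fun ψ => ‖⟪C.correct s ψ, C.encode u⟫_ℂ‖ ^ 2 := fun s =>
    ((C.measurable_correct s).inner measurable_const).norm.pow_const 2
  have hcongr : ∀ s, ∀ ω ∈ S ⁻¹' {s}, ‖⟪C.correct s (Ψ ω), C.encode u⟫_ℂ‖ ^ 2 =
      ‖⟪C.correct (S ω) (Ψ ω), C.encode u⟫_ℂ‖ ^ 2 := fun s ω hω => by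
    rw [Set.mem_preimage, Set.mem_singleton_iff] at hω
    rw [hω]
  have hint : ∀ s, IntegrableOn (fun ω => ‖⟪C.correct (S ω) (Ψ ω), C.encode u⟫_ℂ‖ ^ 2)
      (S ⁻¹' {s}) P := fun s => by
    refine IntegrableOn.congr_fun (f := fun ω => ‖⟪C.correct s (Ψ ω), C.encode u⟫_ℂ‖ ^ 2) ?_
      (hcongr s) (hmeas s)
    refine Integrable.of_bound ((hg s).comp_aemeasurable hΨ.restrict).aestronglyMeasurable
      (‖C.encode u‖ ^ 2) (Filter.Eventually.of_forall fun ω => ?_)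
    rw [Real.norm_of_nonneg (by positivity)]
    gcongr
    exact (norm_inner_le_norm _ _).trans
      (mul_le_of_le_one_left (norm_nonneg _) (norm_correct_le_one C s _))
  have hU : (⋃ s, S ⁻¹' {s}) = Set.univ := by
    rw [← Set.preimage_iUnion, Set.iUnion_of_singleton, Set.preimage_univ]
  rw [← setIntegral_univ, ← hU, integral_iUnion_fintype hmeas
    (fun s t hst => (Set.disjoint_singleton.2 hst).preimage S) hint]
  refine Finset.sum_congr rfl fun s _ => ?_
  rw [← setIntegral_congr_fun (hmeas s) (hcongr s), ← integral_map
    (f := fun ψ => ‖⟪C.correct s ψ, C.encode u⟫_ℂ‖ ^ 2) hΨ.restrict (hg s).aestronglyMeasurable,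
    hS.map_restrict hΨ, integral_withDensity_eq_integral_toReal_smul
      (C.measurable_ofReal_norm_project_sq s)
      (Filter.Eventually.of_forall fun _ => ENNReal.ofReal_lt_top)]
  congr 1
  funext ψ
  rw [ENNReal.toReal_ofReal (by positivity), smul_eq_mul,
    norm_project_sq_mul_norm_inner_correct_sq]

/-- The expected squared overlap of the corrected state with the encoded state. -/
theorem integral_norm_inner_correct_sq_of_hasLaw [IsProbabilityMeasure P] {Φ₀ : Qubits m}
    (hΦ₀ : ‖Φ₀‖ = 1) {σ : ℝ} (hσ0 : 0 ≤ σ) (hσ1 : σ < 1)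
    (hΨ : HasLaw Ψ (normalLaw (C.encode Φ₀) σ) P) (hS : C.IsSyndromeOf P S Ψ) :
    ∫ ω, ‖⟪C.correct (S ω) (Ψ ω), C.encode Φ₀⟫_ℂ‖ ^ 2 ∂P = (1 + (2 ^ m - 1) * σ ^ 2) / 2 ^ m := by
  have hΦ : ‖C.encode Φ₀‖ = 1 := by rw [C.encode.norm_map, hΦ₀]
  have htriv : C.error C.trivialSyndrome (C.encode Φ₀) = C.encode Φ₀ := by
    rw [C.error_trivialSyndrome]; rfl
  rw [integral_norm_inner_correct_sq hS hΨ.aemeasurable, hΨ.map_eq,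
    ← Finset.add_sum_erase _ _ (Finset.mem_univ C.trivialSyndrome), htriv,
    integral_normalLaw_norm_inner_self_sq hΦ hσ0 hσ1, Finset.sum_congr rfl fun s hs =>
      integral_normalLaw_norm_inner_sq_of_orthogonal hΦ hσ0 hσ1
        (((C.error s).norm_map _).trans hΦ) (by
          have h := C.orthogonal _ s (Finset.ne_of_mem_erase hs).symm Φ₀ Φ₀
          rwa [htriv] at h),
    Finset.sum_const, Finset.card_erase_of_mem (Finset.mem_univ _), Finset.card_univ,
    Fintype.card_fin, nsmul_eq_mul, Nat.cast_sub (Fin.pos C.trivialSyndrome), Nat.cast_one]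
  have hdim : (2 : ℝ) ^ n = 2 ^ m * C.numErrors := mod_cast C.dim_eq
  have hpos : (C.numErrors : ℝ) ≠ 0 := Nat.cast_ne_zero.2 (Fin.pos C.trivialSyndrome).ne'
  rw [hdim]
  field_simp
  ring

end QuantumCode

theorem fidelity_sq {k : ℕ} {Ω : Type*} [MeasurableSpace Ω] (P : Measure Ω) (X : Ω → Qubits k)
    (Φ : Qubits k) : fidelity P X Φ ^ 2 = ∫ ω, ‖⟪X ω, Φ⟫_ℂ‖ ^ 2 ∂P :=
  Real.sq_sqrt (integral_nonneg fun _ => by positivity)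

theorem fidelity_sq_of_hasLaw {k : ℕ} {Ω : Type*} [MeasurableSpace Ω] {P : Measure Ω}
    {X : Ω → Qubits k} {Φ : Qubits k} (hΦ : ‖Φ‖ = 1) {σ : ℝ} (hσ0 : 0 ≤ σ) (hσ1 : σ < 1)
    (hX : HasLaw X (normalLaw Φ σ) P) :
    fidelity P X Φ ^ 2 = (1 + (2 ^ k - 1) * σ ^ 2) / 2 ^ k := by
  have hc : Continuous fun ψ : Qubits k => ‖⟪ψ, Φ⟫_ℂ‖ ^ 2 := by fun_prop
  rw [fidelity_sq, ← integral_normalLaw_norm_inner_self_sq hΦ hσ0 hσ1,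
    ← hX.integral_comp hc.aestronglyMeasurable]
  rfl

theorem mainTheorem2 {n m : ℕ} (hn : 1 ≤ n) (C : QuantumCode n m)
    (Φ₀ : Qubits m) (hΦ₀ : ‖Φ₀‖ = 1) (σu σc : ℝ) (hσ0 : 0 ≤ σu) (hσ1 : σu < 1)
    (hσc : σc = σu ^ n) :
    -- the normal distributions are probability distributions
    IsProbabilityMeasure (normalLaw Φ₀ σu) ∧
    IsProbabilityMeasure (normalLaw (C.encode Φ₀) σc) ∧
    -- `Ψ₀` is the disturbed unencoded state, `Ψ` the disturbed encoded state, `S` the syndrome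
    -- measured on `Ψ`, and `fun ω => C.correct (S ω) (Ψ ω)` the corrected state
    ∀ (Ω₀ Ω : Type*) [MeasurableSpace Ω₀] [MeasurableSpace Ω]
      (P₀ : Measure Ω₀) (P : Measure Ω) [IsProbabilityMeasure P₀] [IsProbabilityMeasure P]
      (Ψ₀ : Ω₀ → Qubits m) (Ψ : Ω → Qubits n) (S : Ω → Fin C.numErrors),
      HasLaw Ψ₀ (normalLaw Φ₀ σu) P₀ →
      HasLaw Ψ (normalLaw (C.encode Φ₀) σc) P →
      C.IsSyndromeOf P S Ψ →
      fidelity P₀ Ψ₀ Φ₀ ≥ fidelity P (fun ω => C.correct (S ω) (Ψ ω)) (C.encode Φ₀) ∧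
      fidelity P (fun ω => C.correct (S ω) (Ψ ω)) (C.encode Φ₀) ≥
        fidelity P Ψ (C.encode Φ₀) ∧
      fidelity P₀ Ψ₀ Φ₀ ^ 2 = (1 + (2 ^ m - 1) * σu ^ 2) / 2 ^ m ∧
      fidelity P (fun ω => C.correct (S ω) (Ψ ω)) (C.encode Φ₀) ^ 2 =
        (1 + (2 ^ m - 1) * σc ^ 2) / 2 ^ m ∧
      fidelity P Ψ (C.encode Φ₀) ^ 2 = (1 + (2 ^ n - 1) * σc ^ 2) / 2 ^ n := by
  have hn0 : n ≠ 0 := by omega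
  have hc0 : 0 ≤ σc := hσc ▸ pow_nonneg hσ0 n
  have hc1 : σc < 1 := hσc ▸ pow_lt_one₀ hσ0 hσ1 hn0
  have hcu : σc ≤ σu := hσc ▸ pow_le_of_le_one hσ0 hσ1.le hn0
  have hΦ : ‖C.encode Φ₀‖ = 1 := by rw [C.encode.norm_map, hΦ₀]
  refine ⟨isProbabilityMeasure_normalLaw hΦ₀ hσ0 hσ1, isProbabilityMeasure_normalLaw hΦ hc0 hc1, ?_⟩
  intro Ω₀ Ω _ _ P₀ P _ _ Ψ₀ Ψ S hΨ₀ hΨ hS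
  have h1 := fidelity_sq_of_hasLaw hΦ₀ hσ0 hσ1 hΨ₀
  have h2 := (fidelity_sq P (fun ω => C.correct (S ω) (Ψ ω)) (C.encode Φ₀)).trans
    (QuantumCode.integral_norm_inner_correct_sq_of_hasLaw hΦ₀ hc0 hc1 hΨ hS)
  have h3 := fidelity_sq_of_hasLaw hΦ hc0 hc1 hΨ
  have hm1 : (1 : ℝ) ≤ 2 ^ m := one_le_pow₀ one_le_two
  have hmn : (2 : ℝ) ^ m ≤ 2 ^ n := by
    have h : (2 : ℝ) ^ n = 2 ^ m * C.numErrors := mod_cast C.dim_eq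
    rw [h]
    exact le_mul_of_one_le_right (by positivity)
      (Nat.one_le_cast.2 (Fin.pos C.trivialSyndrome))
  refine ⟨?_, ?_, h1, h2, h3⟩
  · refine (pow_le_pow_iff_left₀ (Real.sqrt_nonneg _) (Real.sqrt_nonneg _) two_ne_zero).1 ?_
    change fidelity _ _ _ ^ 2 ≤ fidelity _ _ _ ^ 2
    rw [h1, h2]
    have := sub_nonneg.2 hm1
    gcongr
  · refine (pow_le_pow_iff_left₀ (Real.sqrt_nonneg _) (Real.sqrt_nonneg _) two_ne_zero).1 ?_
    change fidelity _ _ _ ^ 2 ≤ fidelity _ _ _ ^ 2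
    rw [h2, h3, div_le_div_iff₀ (by positivity) (by positivity)]
    have hc2 : 0 ≤ 1 - σc ^ 2 := by nlinarith
    nlinarith [mul_nonneg hc2 (sub_nonneg.2 hmn)]
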